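/- Let $w=(w_n)_{n\ge 1}$ be any nonincreasing sequence of positive real numbers with $w_n\to 0$ and $\sum_n w_n=\infty$. Let $d(w;1)$ be the Lorentz sequence space of all real sequences $x=(x_n)$ with $$\|x\|=\sup_{\sigma}\sum_{n=1}^\infty w_n\,|x_{\sigma(n)}|<\infty,$$ the supremum being taken over all permutations $\sigma$ of $\mathbb N$, and let $d_*(w;1)$ be its predual, that is, the closed linear span of the coordinate functionals $e_j^*$ in the dual space $d(w;1)^*$ with the dual norm; its elements are identified with the sequences $y=(y_n)$ of their values $y_n=y(e_n)$ at the unit vectors. Both spaces are Banach lattices with the coordinatewise order. A Banach lattice $E$ has the weak Dunford–Pettis property if every weakly compact operator from $E$ into any Banach space maps weakly null sequences of pairwise disjoint vectors of $E$ to norm null sequences. Then neither $d(w;1)$ nor $d_*(w;1)$ has the weak Dunford–Pettis property. -/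

import Mathlib

open Filter Topology
open scoped ENNReal NNReal

/-! ### Banach lattices of real sequences -/

/-- A lattice norm on an ideal of real sequences: a sequence space, ordered coordinatewise, given by
an extended-valued lattice norm `eNorm` that is countably subadditive and controls each coordinate,
together with a solid linear subspace `carrier` on which `eNorm` is finite and which is closed under
absolutely convergent series. -/
structure SeqLattice where
  /-- The norm, as a function on all sequences with values in `[0, ∞]`. -/
  eNorm : (ℕ → ℝ) → ℝ≥0∞
  /-- The sequences that belong to the space. -/
  carrier : Submodule ℝ (ℕ → ℝ)
  eNorm_zero : eNorm 0 = 0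
  eNorm_smul_le : ∀ (c : ℝ) (x : ℕ → ℝ), eNorm (c • x) ≤ ‖c‖ₑ * eNorm x
  eNorm_le_tsum : ∀ (x : ℕ → ℝ) (f : ℕ → ℕ → ℝ),
    (∀ n, ‖x n‖ₑ ≤ ∑' k, ‖f k n‖ₑ) → eNorm x ≤ ∑' k, eNorm (f k)
  coord_le : ∀ n, ∃ C : ℝ≥0, ∀ x, ‖x n‖ₑ ≤ C * eNorm x
  lt_top : ∀ x ∈ carrier, eNorm x < ∞
  solid : ∀ x y : ℕ → ℝ, y ∈ carrier → (∀ n, |x n| ≤ |y n|) → x ∈ carrier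
  tsum_mem : ∀ (x : ℕ → ℝ) (f : ℕ → ℕ → ℝ), (∀ k, f k ∈ carrier) → ∑' k, eNorm (f k) < ∞ →
    (∀ n, HasSum (fun k => f k n) (x n)) → x ∈ carrier

namespace SeqLattice

variable (S : SeqLattice)

theorem eNorm_mono {x y : ℕ → ℝ} (h : ∀ n, |x n| ≤ |y n|) : S.eNorm x ≤ S.eNorm y := by
  have h1 := S.eNorm_le_tsum x (fun k => if k = 0 then y else 0) (fun n => by
    rw [tsum_eq_single 0 (by intro k hk; simp [hk])]
    simpa using enorm_le_iff_norm_le.2 (by simpa using h n))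
  rwa [tsum_eq_single 0 (by intro k hk; simp [hk, S.eNorm_zero]), if_pos rfl] at h1

theorem eNorm_add_le (x y : ℕ → ℝ) : S.eNorm (x + y) ≤ S.eNorm x + S.eNorm y := by
  have key : ∀ g : ℕ → ℝ≥0∞, (∀ k, 2 ≤ k → g k = 0) → ∑' k, g k = g 0 + g 1 := fun g hg => by
    rw [tsum_eq_sum (s := Finset.range 2) (by
      intro k hk; exact hg k (by simp at hk; omega))]
    simp [Finset.sum_range_succ]
  have h1 := S.eNorm_le_tsum (x + y) (fun k => if k = 0 then x else if k = 1 then y else 0)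
    (fun n => by
      rw [key _ (by intro k hk; simp [show k ≠ 0 by omega, show k ≠ 1 by omega])]
      simpa using enorm_add_le (x n) (y n))
  rw [key _ (by intro k hk; simp [show k ≠ 0 by omega, show k ≠ 1 by omega, S.eNorm_zero])] at h1
  simpa using h1

/-- The sequence space itself, with the norm `eNorm` and the coordinatewise order. -/
def Elem : Type := S.carrier

namespace Elem

variable {S}

/-- The sequence of coordinates of an element. -/
def coords (x : S.Elem) : ℕ → ℝ := Subtype.val x

/-- The element of the space given by a sequence in `carrier`. -/
def mk (x : ℕ → ℝ) (hx : x ∈ S.carrier) : S.Elem := Subtype.mk x hx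

instance : CoeFun S.Elem (fun _ => ℕ → ℝ) := ⟨coords⟩

theorem mem (x : S.Elem) : x.coords ∈ S.carrier := Subtype.property x

@[simp] theorem mk_coords (x : ℕ → ℝ) (hx : x ∈ S.carrier) : (mk x hx).coords = x := rfl

instance : AddCommGroup S.Elem := inferInstanceAs (AddCommGroup S.carrier)

instance : Module ℝ S.Elem := inferInstanceAs (Module ℝ S.carrier)

@[ext] theorem ext {x y : S.Elem} (h : ∀ n, x n = y n) : x = y := Subtype.ext (funext h)

@[simp] theorem zero_apply (n : ℕ) : (0 : S.Elem) n = 0 := rfl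
@[simp] theorem add_apply (x y : S.Elem) (n : ℕ) : (x + y) n = x n + y n := rfl
@[simp] theorem neg_apply (x : S.Elem) (n : ℕ) : (-x) n = -x n := rfl
@[simp] theorem sub_apply (x y : S.Elem) (n : ℕ) : (x - y) n = x n - y n := rfl
@[simp] theorem smul_apply (c : ℝ) (x : S.Elem) (n : ℕ) : (c • x) n = c * x n := rfl

theorem abs_mem {x : ℕ → ℝ} (hx : x ∈ S.carrier) : |x| ∈ S.carrier :=
  S.solid _ x hx (fun n => by simp [Pi.abs_apply])

/-- The coordinatewise order. -/
instance : Lattice S.Elem :=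
  Subtype.lattice (P := fun x : ℕ → ℝ => x ∈ S.carrier)
    (fun {x y} hx hy => S.solid _ _ (S.carrier.add_mem (abs_mem hx) (abs_mem hy)) (fun n => by
      have h : |x n| + |y n| = |(|x| + |y|) n| := by
        simp only [Pi.add_apply, Pi.abs_apply]
        exact (abs_of_nonneg (by positivity)).symm
      rw [← h]
      have hx := abs_nonneg (x n)
      have hy := abs_nonneg (y n)
      rcases le_total (x n) (y n) with h | h <;> simp [h]))
    (fun {x y} hx hy => S.solid _ _ (S.carrier.add_mem (abs_mem hx) (abs_mem hy)) (fun n => by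
      have h : |x n| + |y n| = |(|x| + |y|) n| := by
        simp only [Pi.add_apply, Pi.abs_apply]
        exact (abs_of_nonneg (by positivity)).symm
      rw [← h]
      have hx := abs_nonneg (x n)
      have hy := abs_nonneg (y n)
      rcases le_total (x n) (y n) with h | h <;> simp [h]))

theorem le_def {x y : S.Elem} : x ≤ y ↔ ∀ n, x n ≤ y n := Iff.rfl

@[simp] theorem sup_apply (x y : S.Elem) (n : ℕ) : (x ⊔ y) n = max (x n) (y n) := rfl
@[simp] theorem inf_apply (x y : S.Elem) (n : ℕ) : (x ⊓ y) n = min (x n) (y n) := rfl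
@[simp] theorem abs_apply (x : S.Elem) (n : ℕ) : |x| n = |x n| := rfl

instance : IsOrderedAddMonoid S.Elem where
  add_le_add_left x y h z := le_def.2 fun n => by
    simpa using le_def.1 h n

instance : PosSMulMono ℝ S.Elem where
  smul_le_smul_of_nonneg_left c hc x y h := le_def.2 fun n => by
    simpa using mul_le_mul_of_nonneg_left (le_def.1 h n) hc

theorem ne_top (x : S.Elem) : S.eNorm x ≠ ∞ := (S.lt_top _ x.mem).ne

noncomputable instance : NormedAddCommGroup S.Elem :=
  AddGroupNorm.toNormedAddCommGroup
    { toFun := fun x => (S.eNorm x).toReal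
      map_zero' := by
        show (S.eNorm 0).toReal = 0
        simp [S.eNorm_zero]
      add_le' := fun x y => by
        rw [← ENNReal.toReal_add x.ne_top y.ne_top]
        exact ENNReal.toReal_mono (ENNReal.add_ne_top.2 ⟨x.ne_top, y.ne_top⟩)
          (S.eNorm_add_le x y)
      neg' := fun x => by
        congr 1
        exact le_antisymm (S.eNorm_mono (fun n => by simp)) (S.eNorm_mono (fun n => by simp))
      eq_zero_of_map_eq_zero' := fun x hx => by
        have h0 : S.eNorm x = 0 := by
          simpa [ENNReal.toReal_eq_zero_iff, x.ne_top] using hx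
        ext n
        obtain ⟨C, hC⟩ := S.coord_le n
        have := hC x
        rw [h0, mul_zero] at this
        simpa using this }

theorem norm_def (x : S.Elem) : ‖x‖ = (S.eNorm x).toReal := rfl

theorem ofReal_norm_eq (x : S.Elem) : ENNReal.ofReal ‖x‖ = S.eNorm x :=
  ENNReal.ofReal_toReal x.ne_top

noncomputable instance : NormedSpace ℝ S.Elem where
  norm_smul_le c x := by
    have h := ENNReal.toReal_mono (ENNReal.mul_ne_top (by simp) x.ne_top) (S.eNorm_smul_le c x)
    rw [ENNReal.toReal_mul, toReal_enorm] at h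
    exact h

instance : HasSolidNorm S.Elem where
  solid _ y h := ENNReal.toReal_mono y.ne_top (S.eNorm_mono (fun n => h n))

theorem sum_apply (u : ℕ → S.Elem) (s : Finset ℕ) (n : ℕ) :
    (∑ i ∈ s, u i) n = ∑ i ∈ s, u i n := by
  classical
  induction s using Finset.induction_on with
  | empty => simp
  | insert a s ha ih => rw [Finset.sum_insert ha, Finset.sum_insert ha, add_apply, ih]

instance : CompleteSpace S.Elem := by
  refine NormedAddCommGroup.completeSpace_of_summable_imp_tendsto (fun u hu => ?_)
  have hsum : ∑' k, S.eNorm (u k) ≠ ∞ := by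
    have := hu.tsum_ofReal_ne_top
    simpa only [ofReal_norm_eq] using this
  have hcs : ∀ n, Summable (fun k => u k n) := fun n => by
    obtain ⟨C, hC⟩ := S.coord_le n
    refine Summable.of_norm ?_
    refine Summable.of_nonneg_of_le (fun _ => norm_nonneg _) (fun k => ?_) (hu.mul_left (C : ℝ))
    have := ENNReal.toReal_mono (ENNReal.mul_ne_top (by simp) (u k).ne_top) (hC (u k))
    simpa [ENNReal.toReal_mul, norm_def] using this
  let a : S.Elem := mk (fun n => ∑' k, u k n)
    (S.tsum_mem _ (fun k => u k) (fun k => (u k).mem) hsum.lt_top (fun n => (hcs n).hasSum))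
  refine ⟨a, ?_⟩
  have htail : Tendsto (fun N => (∑' k, S.eNorm (u (k + N))).toReal) atTop (𝓝 0) := by
    have := ENNReal.tendsto_sum_nat_add (fun k => S.eNorm (u k)) hsum
    have h := (ENNReal.tendsto_toReal ENNReal.zero_ne_top).comp this
    rwa [ENNReal.toReal_zero] at h
  rw [tendsto_iff_norm_sub_tendsto_zero]
  refine squeeze_zero (fun _ => norm_nonneg _) (fun N => ?_) htail
  have hfin : ∑' k, S.eNorm (u (k + N)) ≠ ∞ :=
    ne_top_of_le_ne_top hsum
      (ENNReal.tsum_comp_le_tsum_of_injective (add_left_injective N) (fun k => S.eNorm (u k)))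
  refine ENNReal.toReal_mono hfin (S.eNorm_le_tsum _ (fun k => u (k + N)) (fun n => ?_))
  have h1 : (∑ i ∈ Finset.range N, u i - a) n = -∑' k, u (k + N) n := by
    have := (hcs n).sum_add_tsum_nat_add N
    rw [sub_apply, sum_apply]
    show _ - ∑' k, u k n = _
    linarith
  rw [h1, enorm_neg]
  exact enorm_tsum_le_tsum_enorm

end Elem

end SeqLattice

/-! ### Lorentz sequence spaces and their preduals -/

/-- A Lorentz weight: a nonincreasing null sequence of positive numbers with divergent sum. -/
structure LorentzWeight where
  /-- The sequence of weights. -/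
  toFun : ℕ → ℝ
  pos : ∀ n, 0 < toFun n
  antitone : Antitone toFun
  tendsto_zero : Tendsto toFun atTop (𝓝 0)
  not_summable : ¬ Summable toFun

namespace LorentzWeight

instance : CoeFun LorentzWeight (fun _ => ℕ → ℝ) := ⟨toFun⟩

noncomputable instance : Inhabited LorentzWeight :=
  ⟨{ toFun := fun n => 1 / ((n : ℝ) + 1)
     pos := fun n => by positivity
     antitone := fun m n h => by
       have : (m : ℝ) ≤ n := by exact_mod_cast h
       exact one_div_le_one_div_of_le (by positivity) (by linarith)
     tendsto_zero := tendsto_one_div_add_atTop_nhds_zero_nat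
     not_summable := fun h => Real.not_summable_one_div_natCast
       ((summable_nat_add_iff (f := fun n : ℕ => 1 / (n : ℝ)) 1).1 (by simpa using h)) }⟩

variable (w : LorentzWeight)

/-- The norm of `d(w;1)`: the supremum of `∑ w n * |x (σ n)|` over all permutations `σ` of `ℕ`. -/
noncomputable def eNorm (x : ℕ → ℝ) : ℝ≥0∞ :=
  ⨆ σ : Equiv.Perm ℕ, ∑' n, ‖w n‖ₑ * ‖x (σ n)‖ₑ

/-- The dual norm: the supremum of `∑ |x n * y n|` over all `x` in the unit ball of `d(w;1)`. -/
noncomputable def dualENorm (y : ℕ → ℝ) : ℝ≥0∞ :=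
  ⨆ (x : ℕ → ℝ) (_ : w.eNorm x ≤ 1), ∑' n, ‖x n‖ₑ * ‖y n‖ₑ

/-- The sequence `y` with its first `N` coordinates replaced by zero. -/
def tail (N : ℕ) (y : ℕ → ℝ) : ℕ → ℝ := fun k => if k < N then 0 else y k

theorem enorm_ne_zero' (n : ℕ) : ‖w n‖ₑ ≠ 0 := by simpa using (w.pos n).ne'

theorem eNorm_le_tsum (x : ℕ → ℝ) (f : ℕ → ℕ → ℝ) (h : ∀ n, ‖x n‖ₑ ≤ ∑' k, ‖f k n‖ₑ) :
    w.eNorm x ≤ ∑' k, w.eNorm (f k) := by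
  refine iSup_le fun σ => ?_
  calc ∑' n, ‖w n‖ₑ * ‖x (σ n)‖ₑ ≤ ∑' n, ∑' k, ‖w n‖ₑ * ‖f k (σ n)‖ₑ := by
        refine ENNReal.tsum_le_tsum fun n => ?_
        rw [ENNReal.tsum_mul_left]
        gcongr
        exact h (σ n)
    _ = ∑' k, ∑' n, ‖w n‖ₑ * ‖f k (σ n)‖ₑ := ENNReal.tsum_comm
    _ ≤ ∑' k, w.eNorm (f k) := ENNReal.tsum_le_tsum fun k =>
        le_iSup (fun σ : Equiv.Perm ℕ => ∑' n, ‖w n‖ₑ * ‖f k (σ n)‖ₑ) σ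

theorem dualENorm_le_tsum (x : ℕ → ℝ) (f : ℕ → ℕ → ℝ) (h : ∀ n, ‖x n‖ₑ ≤ ∑' k, ‖f k n‖ₑ) :
    w.dualENorm x ≤ ∑' k, w.dualENorm (f k) := by
  refine iSup₂_le fun z hz => ?_
  calc ∑' n, ‖z n‖ₑ * ‖x n‖ₑ ≤ ∑' n, ∑' k, ‖z n‖ₑ * ‖f k n‖ₑ := by
        refine ENNReal.tsum_le_tsum fun n => ?_
        rw [ENNReal.tsum_mul_left]
        gcongr
        exact h n
    _ = ∑' k, ∑' n, ‖z n‖ₑ * ‖f k n‖ₑ := ENNReal.tsum_comm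
    _ ≤ ∑' k, w.dualENorm (f k) := ENNReal.tsum_le_tsum fun k =>
        le_iSup₂ (f := fun (z : ℕ → ℝ) (_ : w.eNorm z ≤ 1) => ∑' n, ‖z n‖ₑ * ‖f k n‖ₑ) z hz

theorem eNorm_zero : w.eNorm 0 = 0 := by simp [eNorm]

theorem dualENorm_zero : w.dualENorm 0 = 0 := by simp [dualENorm]

theorem eNorm_smul_le (c : ℝ) (x : ℕ → ℝ) : w.eNorm (c • x) ≤ ‖c‖ₑ * w.eNorm x := by
  refine iSup_le fun σ => ?_
  have : ∑' n, ‖w n‖ₑ * ‖(c • x) (σ n)‖ₑ = ‖c‖ₑ * ∑' n, ‖w n‖ₑ * ‖x (σ n)‖ₑ := by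
    rw [← ENNReal.tsum_mul_left]
    refine tsum_congr fun n => ?_
    rw [Pi.smul_apply, smul_eq_mul, enorm_mul]
    ring
  rw [this]
  gcongr
  exact le_iSup (fun σ : Equiv.Perm ℕ => ∑' n, ‖w n‖ₑ * ‖x (σ n)‖ₑ) σ

theorem dualENorm_smul_le (c : ℝ) (x : ℕ → ℝ) : w.dualENorm (c • x) ≤ ‖c‖ₑ * w.dualENorm x := by
  refine iSup₂_le fun z hz => ?_
  have : ∑' n, ‖z n‖ₑ * ‖(c • x) n‖ₑ = ‖c‖ₑ * ∑' n, ‖z n‖ₑ * ‖x n‖ₑ := by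
    rw [← ENNReal.tsum_mul_left]
    refine tsum_congr fun n => ?_
    rw [Pi.smul_apply, smul_eq_mul, enorm_mul]
    ring
  rw [this]
  gcongr
  exact le_iSup₂ (f := fun (z : ℕ → ℝ) (_ : w.eNorm z ≤ 1) => ∑' n, ‖z n‖ₑ * ‖x n‖ₑ) z hz

theorem coord_le_eNorm (x : ℕ → ℝ) (n : ℕ) : ‖w 0‖ₑ * ‖x n‖ₑ ≤ w.eNorm x := by
  have h1 := ENNReal.le_tsum (f := fun k => ‖w k‖ₑ * ‖x (Equiv.swap 0 n k)‖ₑ) 0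
  simp only [Equiv.swap_apply_left] at h1
  exact h1.trans (le_iSup (fun σ : Equiv.Perm ℕ => ∑' n, ‖w n‖ₑ * ‖x (σ n)‖ₑ) (Equiv.swap 0 n))

theorem eNorm_single_le (n : ℕ) (c : ℝ) : w.eNorm (Pi.single n c) ≤ ‖w 0‖ₑ * ‖c‖ₑ := by
  refine iSup_le fun σ => ?_
  rw [tsum_eq_single (σ.symm n) (fun k hk => by
    have : σ k ≠ n := fun h => hk (by simp [← h])
    simp [Pi.single_eq_of_ne this])]
  simp only [Equiv.apply_symm_apply, Pi.single_eq_same]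
  gcongr
  refine enorm_le_iff_norm_le.2 ?_
  rw [Real.norm_of_nonneg (w.pos _).le, Real.norm_of_nonneg (w.pos _).le]
  exact w.antitone (Nat.zero_le _)

theorem coord_le_dualENorm (y : ℕ → ℝ) (n : ℕ) : ‖y n‖ₑ ≤ ‖w 0‖ₑ * w.dualENorm y := by
  have h0 : ‖(w 0)⁻¹‖ₑ = ‖w 0‖ₑ⁻¹ := enorm_inv (w.pos 0).ne'
  have hle : w.eNorm (Pi.single n (w 0)⁻¹) ≤ 1 := by
    refine (w.eNorm_single_le n _).trans ?_
    rw [h0, ENNReal.mul_inv_cancel (w.enorm_ne_zero' 0) (by simp)]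
  have h1 := le_iSup₂ (f := fun (z : ℕ → ℝ) (_ : w.eNorm z ≤ 1) => ∑' n, ‖z n‖ₑ * ‖y n‖ₑ) _ hle
  have h2 := (ENNReal.le_tsum (f := fun k => ‖(Pi.single n (w 0)⁻¹ : ℕ → ℝ) k‖ₑ * ‖y k‖ₑ) n).trans h1
  rw [Pi.single_eq_same, h0] at h2
  calc ‖y n‖ₑ = ‖w 0‖ₑ * (‖w 0‖ₑ⁻¹ * ‖y n‖ₑ) := by
        rw [← mul_assoc, ENNReal.mul_inv_cancel (w.enorm_ne_zero' 0) (by simp), one_mul]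
    _ ≤ _ := by gcongr; exact h2

theorem dualENorm_add_le (x y : ℕ → ℝ) :
    w.dualENorm (x + y) ≤ w.dualENorm x + w.dualENorm y := by
  refine iSup₂_le fun z hz => ?_
  calc ∑' n, ‖z n‖ₑ * ‖(x + y) n‖ₑ ≤ ∑' n, (‖z n‖ₑ * ‖x n‖ₑ + ‖z n‖ₑ * ‖y n‖ₑ) := by
        refine ENNReal.tsum_le_tsum fun n => ?_
        rw [← mul_add]
        gcongr
        exact enorm_add_le _ _
    _ = _ := ENNReal.tsum_add
    _ ≤ _ := add_le_add
      (le_iSup₂ (f := fun (z : ℕ → ℝ) (_ : w.eNorm z ≤ 1) => ∑' n, ‖z n‖ₑ * ‖x n‖ₑ) z hz)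
      (le_iSup₂ (f := fun (z : ℕ → ℝ) (_ : w.eNorm z ≤ 1) => ∑' n, ‖z n‖ₑ * ‖y n‖ₑ) z hz)

theorem eNorm_mono {x y : ℕ → ℝ} (h : ∀ n, |x n| ≤ |y n|) : w.eNorm x ≤ w.eNorm y := by
  refine iSup_mono fun σ => ENNReal.tsum_le_tsum fun n => ?_
  gcongr
  exact enorm_le_iff_norm_le.2 (h _)

theorem dualENorm_mono {x y : ℕ → ℝ} (h : ∀ n, |x n| ≤ |y n|) :
    w.dualENorm x ≤ w.dualENorm y := by
  refine iSup₂_mono fun z _ => ENNReal.tsum_le_tsum fun n => ?_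
  gcongr
  exact enorm_le_iff_norm_le.2 (h _)

/-- The data of `d(w;1)`: all sequences of finite Lorentz norm. -/
noncomputable def lorentz : SeqLattice where
  eNorm := w.eNorm
  carrier :=
    { carrier := {x | w.eNorm x < ∞}
      zero_mem' := by simp [w.eNorm_zero]
      add_mem' := fun {x y} hx hy => by
        have h : w.eNorm (x + y) ≤ w.eNorm x + w.eNorm y := by
          refine iSup_le fun σ => ?_
          calc ∑' n, ‖w n‖ₑ * ‖(x + y) (σ n)‖ₑ
              ≤ ∑' n, (‖w n‖ₑ * ‖x (σ n)‖ₑ + ‖w n‖ₑ * ‖y (σ n)‖ₑ) := by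
                refine ENNReal.tsum_le_tsum fun n => ?_
                rw [← mul_add]
                gcongr
                exact enorm_add_le _ _
            _ = _ := ENNReal.tsum_add
            _ ≤ _ := add_le_add
              (le_iSup (fun σ : Equiv.Perm ℕ => ∑' n, ‖w n‖ₑ * ‖x (σ n)‖ₑ) σ)
              (le_iSup (fun σ : Equiv.Perm ℕ => ∑' n, ‖w n‖ₑ * ‖y (σ n)‖ₑ) σ)
        exact h.trans_lt (ENNReal.add_lt_top.2 ⟨hx, hy⟩)
      smul_mem' := fun c x hx => (w.eNorm_smul_le c x).trans_lt (ENNReal.mul_lt_top (by simp) hx) }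
  eNorm_zero := w.eNorm_zero
  eNorm_smul_le := w.eNorm_smul_le
  eNorm_le_tsum := w.eNorm_le_tsum
  coord_le n := ⟨(‖w 0‖₊)⁻¹, fun x => by
    have h := w.coord_le_eNorm x n
    calc ‖x n‖ₑ = ‖w 0‖ₑ⁻¹ * (‖w 0‖ₑ * ‖x n‖ₑ) := by
          rw [← mul_assoc, ENNReal.inv_mul_cancel (w.enorm_ne_zero' 0) (by simp), one_mul]
      _ ≤ ‖w 0‖ₑ⁻¹ * w.eNorm x := by gcongr
      _ = _ := by
        rw [ENNReal.coe_inv (by simpa using (w.pos 0).ne')]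
        rfl⟩
  lt_top x hx := hx
  solid x y hy h := (w.eNorm_mono h).trans_lt hy
  tsum_mem x f _ hs hx := (w.eNorm_le_tsum x f (fun n => by
    rw [← (hx n).tsum_eq]
    exact enorm_tsum_le_tsum_enorm)).trans_lt hs

theorem abs_tail_le (N : ℕ) (y : ℕ → ℝ) (n : ℕ) : |tail N y n| ≤ |y n| := by
  unfold tail
  split_ifs <;> simp

/-- The data of `d_*(w;1)`: all sequences `y` of finite dual norm whose tails tend to zero in the
dual norm, that is, the closed linear span of the coordinate functionals in the dual of `d(w;1)`. -/
noncomputable def lorentzPredual : SeqLattice where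
  eNorm := w.dualENorm
  carrier :=
    { carrier := {y | w.dualENorm y < ∞ ∧
        Tendsto (fun N => w.dualENorm (tail N y)) atTop (𝓝 0)}
      zero_mem' := by
        have h : ∀ N, tail N 0 = 0 := fun N => by ext; simp [tail]
        simp [w.dualENorm_zero, h]
      add_mem' := fun {x y} hx hy => by
        refine ⟨(w.dualENorm_add_le x y).trans_lt (ENNReal.add_lt_top.2 ⟨hx.1, hy.1⟩), ?_⟩
        have h : ∀ N, tail N (x + y) = tail N x + tail N y := fun N => by
          ext k
          by_cases hk : k < N <;> simp [tail, hk]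
        refine tendsto_of_tendsto_of_tendsto_of_le_of_le tendsto_const_nhds
          (by simpa using hx.2.add hy.2) (fun _ => bot_le) (fun N => ?_)
        simp only [h]
        exact w.dualENorm_add_le _ _
      smul_mem' := fun c x hx => by
        refine ⟨(w.dualENorm_smul_le c x).trans_lt (ENNReal.mul_lt_top (by simp) hx.1), ?_⟩
        have h : ∀ N, tail N (c • x) = c • tail N x := fun N => by
          ext k
          by_cases hk : k < N <;> simp [tail, hk]
        refine tendsto_of_tendsto_of_tendsto_of_le_of_le tendsto_const_nhds
          (by simpa using ENNReal.Tendsto.const_mul (a := ‖c‖ₑ) hx.2 (Or.inr (by simp)))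
          (fun _ => bot_le) (fun N => ?_)
        simp only [h]
        exact w.dualENorm_smul_le _ _ }
  eNorm_zero := w.dualENorm_zero
  eNorm_smul_le := w.dualENorm_smul_le
  eNorm_le_tsum := w.dualENorm_le_tsum
  coord_le n := ⟨‖w 0‖₊, fun x => w.coord_le_dualENorm x n⟩
  lt_top x hx := hx.1
  solid x y hy h := ⟨(w.dualENorm_mono h).trans_lt hy.1, by
    refine tendsto_of_tendsto_of_tendsto_of_le_of_le tendsto_const_nhds hy.2
      (fun _ => bot_le) (fun N => w.dualENorm_mono fun n => ?_)
    unfold tail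
    split_ifs
    · simp
    · exact h n⟩
  tsum_mem x f hf hs hx := by
    refine ⟨(w.dualENorm_le_tsum x f (fun n => by
      rw [← (hx n).tsum_eq]
      exact enorm_tsum_le_tsum_enorm)).trans_lt hs, ?_⟩
    have hlim : Tendsto (fun N => ∑' k, w.dualENorm (tail N (f k))) atTop (𝓝 0) := by
      simp only [← MeasureTheory.lintegral_count]
      have := MeasureTheory.tendsto_lintegral_of_dominated_convergence
        (μ := MeasureTheory.Measure.count) (F := fun N k => w.dualENorm (tail N (f k)))
        (f := fun _ : ℕ => 0) (fun k => w.dualENorm (f k)) (fun N => measurable_of_countable _)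
        (fun N => Eventually.of_forall fun k => w.dualENorm_mono (abs_tail_le N (f k)))
        (by simpa only [MeasureTheory.lintegral_count] using hs.ne)
        (Eventually.of_forall fun k => (hf k).2)
      simpa using this
    refine tendsto_of_tendsto_of_tendsto_of_le_of_le tendsto_const_nhds hlim
      (fun _ => bot_le) (fun N => w.dualENorm_le_tsum _ _ fun n => ?_)
    by_cases hn : n < N
    · simp [tail, hn]
    · simp only [tail, hn, if_false]
      rw [← (hx n).tsum_eq]
      exact enorm_tsum_le_tsum_enorm

end LorentzWeight

/-- The Lorentz sequence space `d(w;1)` as a Banach lattice. -/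
abbrev LorentzSpace (w : LorentzWeight) : Type := w.lorentz.Elem

/-- The predual `d_*(w;1)` of the Lorentz sequence space `d(w;1)` as a Banach lattice. -/
abbrev LorentzPredual (w : LorentzWeight) : Type := w.lorentzPredual.Elem

namespace LorentzWeight

variable (w : LorentzWeight)

theorem tsum_mul_le (x : LorentzSpace w) (y : LorentzPredual w) :
    ∑' n, ‖x n‖ₑ * ‖y n‖ₑ ≤ w.eNorm x * w.dualENorm y := by
  have hx : w.eNorm x ≠ ∞ := x.ne_top
  by_cases h0 : w.eNorm x = 0
  · have : ∀ n, ‖x n‖ₑ = 0 := fun n => by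
      have := w.coord_le_eNorm x n
      rw [h0] at this
      simpa [(w.pos 0).ne'] using this
    simp [this]
  have hr : 0 < (w.eNorm x).toReal := ENNReal.toReal_pos h0 hx
  have hre : ‖(w.eNorm x).toReal⁻¹‖ₑ = (w.eNorm x)⁻¹ := by
    rw [enorm_inv hr.ne', Real.enorm_of_nonneg hr.le, ENNReal.ofReal_toReal hx]
  have h1 : w.eNorm ((w.eNorm x).toReal⁻¹ • (x : ℕ → ℝ)) ≤ 1 := by
    refine (w.eNorm_smul_le _ _).trans ?_
    rw [hre, ENNReal.inv_mul_cancel h0 hx]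
  have h2 := le_iSup₂ (f := fun (z : ℕ → ℝ) (_ : w.eNorm z ≤ 1) => ∑' n, ‖z n‖ₑ * ‖y n‖ₑ) _ h1
  have h3 : ∑' n, ‖((w.eNorm x).toReal⁻¹ • (x : ℕ → ℝ)) n‖ₑ * ‖y n‖ₑ
      = (w.eNorm x)⁻¹ * ∑' n, ‖x n‖ₑ * ‖y n‖ₑ := by
    rw [← ENNReal.tsum_mul_left]
    refine tsum_congr fun n => ?_
    rw [Pi.smul_apply, smul_eq_mul, enorm_mul, hre, mul_assoc]
  rw [h3] at h2
  calc ∑' n, ‖x n‖ₑ * ‖y n‖ₑ = w.eNorm x * ((w.eNorm x)⁻¹ * ∑' n, ‖x n‖ₑ * ‖y n‖ₑ) := by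
        rw [← mul_assoc, ENNReal.mul_inv_cancel h0 hx, one_mul]
    _ ≤ _ := by gcongr; exact h2

theorem summable_mul (x : LorentzSpace w) (y : LorentzPredual w) :
    Summable (fun n => x n * y n) ∧ |∑' n, x n * y n| ≤ ‖x‖ * ‖y‖ := by
  have hfin : w.eNorm x * w.dualENorm y ≠ ∞ := ENNReal.mul_ne_top x.ne_top y.ne_top
  have h : ∑' n, ‖x n * y n‖ₑ ≤ w.eNorm x * w.dualENorm y := by
    simpa only [enorm_mul] using w.tsum_mul_le x y
  refine ⟨Summable.of_enorm (ne_top_of_le_ne_top hfin h), ?_⟩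
  have := ENNReal.toReal_mono hfin (enorm_tsum_le_tsum_enorm.trans h)
  rw [ENNReal.toReal_mul, toReal_enorm] at this
  exact this

theorem dualENorm_single_lt_top (n : ℕ) (c : ℝ) : w.dualENorm (Pi.single n c) < ∞ := by
  refine lt_of_le_of_lt (b := ‖w 0‖ₑ⁻¹ * ‖c‖ₑ) (iSup₂_le fun z hz => ?_)
    (ENNReal.mul_lt_top (by simpa using (w.pos 0).ne') (by simp))
  rw [tsum_eq_single n (fun k hk => by simp [Pi.single_eq_of_ne hk]), Pi.single_eq_same]
  gcongr
  rw [ENNReal.le_inv_iff_mul_le, mul_comm]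
  exact (w.coord_le_eNorm z n).trans hz

/-- The `n`-th coordinate functional as an element of `d_*(w;1)`. -/
noncomputable def coordFunctional (n : ℕ) : LorentzPredual w :=
  .mk (Pi.single n 1) ⟨w.dualENorm_single_lt_top n 1, by
    refine tendsto_const_nhds.congr' ((eventually_gt_atTop n).mono fun N hN => ?_)
    have : tail N (Pi.single n 1) = 0 := by
      ext k
      by_cases hk : k < N
      · simp [tail, hk]
      · simp [tail, hk, show k ≠ n by omega]
    exact (by rw [this, w.dualENorm_zero] : 0 = w.dualENorm (tail N (Pi.single n 1)))⟩

theorem coordFunctional_apply (n k : ℕ) :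
    w.coordFunctional n k = if k = n then 1 else 0 := Pi.single_apply _ _ _

theorem tendsto_sum_coordFunctional (y : LorentzPredual w) :
    Tendsto (fun N => ∑ n ∈ Finset.range N, y n • w.coordFunctional n) atTop (𝓝 y) := by
  rw [tendsto_iff_norm_sub_tendsto_zero]
  have h := (ENNReal.tendsto_toReal ENNReal.zero_ne_top).comp y.mem.2
  rw [ENNReal.toReal_zero] at h
  refine squeeze_zero (fun _ => norm_nonneg _) (fun N => ?_) h
  refine ENNReal.toReal_mono ?_ (w.dualENorm_mono fun k => ?_)
  · exact ((w.dualENorm_mono (abs_tail_le N y)).trans_lt y.mem.1).ne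
  · rw [SeqLattice.Elem.sub_apply, SeqLattice.Elem.sum_apply]
    simp only [SeqLattice.Elem.smul_apply, coordFunctional_apply, tail]
    by_cases hk : k < N <;> simp [hk]

theorem eNorm_le_of_functional (f : StrongDual ℝ (LorentzPredual w)) :
    w.eNorm (fun n => f (w.coordFunctional n)) ≤ ENNReal.ofReal ‖f‖ := by
  refine iSup_le fun σ => ?_
  rw [ENNReal.tsum_eq_iSup_sum]
  refine iSup_le fun s => ?_
  set x : ℕ → ℝ := fun n => f (w.coordFunctional n) with hx
  let y : LorentzPredual w :=
    ∑ n ∈ s, (w n * SignType.sign (x (σ n)) : ℝ) • w.coordFunctional (σ n)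
  have hfy : f y = ∑ n ∈ s, w n * |x (σ n)| := by
    simp only [y, map_sum, map_smul, smul_eq_mul]
    refine Finset.sum_congr rfl fun n _ => ?_
    rw [mul_assoc]
    congr 1
    exact sign_mul_self _
  have hy : ∀ n, ‖y (σ n)‖ₑ ≤ ‖w n‖ₑ := fun n => by
    refine enorm_le_iff_norm_le.2 ?_
    simp only [y, SeqLattice.Elem.sum_apply, SeqLattice.Elem.smul_apply, coordFunctional_apply,
      EmbeddingLike.apply_eq_iff_eq, mul_ite, mul_one, mul_zero, Finset.sum_ite_eq]
    split_ifs
    · rw [norm_mul]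
      refine mul_le_of_le_one_right (norm_nonneg _) ?_
      rcases lt_trichotomy (x (σ n)) 0 with h | h | h <;> simp [h]
    · simp
  have hny : ‖y‖ ≤ 1 := by
    refine ENNReal.toReal_le_of_le_ofReal zero_le_one (iSup₂_le fun z hz => ?_)
    rw [ENNReal.ofReal_one, ← Equiv.tsum_eq σ]
    refine le_trans (ENNReal.tsum_le_tsum fun n => ?_)
      ((le_iSup (fun σ : Equiv.Perm ℕ => ∑' n, ‖w n‖ₑ * ‖z (σ n)‖ₑ) σ).trans hz)
    rw [mul_comm]
    gcongr
    exact hy n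
  have hle : ∑ n ∈ s, w n * |x (σ n)| ≤ ‖f‖ := by
    rw [← hfy]
    refine (le_abs_self _).trans ((f.le_opNorm y).trans ?_)
    exact mul_le_of_le_one_right (norm_nonneg _) hny
  refine le_trans (le_of_eq ?_) (ENNReal.ofReal_le_ofReal hle)
  rw [ENNReal.ofReal_sum_of_nonneg fun n _ => mul_nonneg (w.pos n).le (abs_nonneg _)]
  refine Finset.sum_congr rfl fun n _ => ?_
  rw [ENNReal.ofReal_mul (w.pos n).le, Real.enorm_of_nonneg (w.pos n).le,
    Real.enorm_eq_ofReal_abs]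

/-- `d_*(w;1)` is indeed a predual of `d(w;1)`: the pairing `∑ x n * y n` identifies `d(w;1)`,
isometrically and as an ordered space, with the dual of `d_*(w;1)`. -/
theorem exists_dual_equiv :
    ∃ Φ : LorentzSpace w ≃ₗᵢ[ℝ] StrongDual ℝ (LorentzPredual w),
      (∀ x y, HasSum (fun n => x n * y n) (Φ x y)) ∧
      ∀ x, 0 ≤ x ↔ ∀ y : LorentzPredual w, 0 ≤ y → 0 ≤ Φ x y := by
  let L : LorentzSpace w →ₗ[ℝ] StrongDual ℝ (LorentzPredual w) :=
    { toFun := fun x => LinearMap.mkContinuous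
        { toFun := fun y => ∑' n, x n * y n
          map_add' := fun y z => by
            rw [← (w.summable_mul x y).1.tsum_add (w.summable_mul x z).1]
            exact tsum_congr fun n => by simp [mul_add]
          map_smul' := fun c y => by
            rw [RingHom.id_apply, smul_eq_mul, ← tsum_mul_left]
            exact tsum_congr fun n => by simp [mul_left_comm] } ‖x‖
        (fun y => (w.summable_mul x y).2)
      map_add' := fun x z => by
        ext y
        refine Eq.trans (tsum_congr fun n => ?_)
          ((w.summable_mul x y).1.tsum_add (w.summable_mul z y).1)
        simp [add_mul]
      map_smul' := fun c x => by
        ext y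
        refine Eq.trans (tsum_congr fun n => ?_) tsum_mul_left
        simp [mul_assoc] }
  have hL : ∀ x y, L x y = ∑' n, x n * y n := fun x y => rfl
  have hLe : ∀ x n, L x (w.coordFunctional n) = x n := fun x n => by
    rw [hL, tsum_eq_single n (fun k hk => by simp [coordFunctional_apply, hk])]
    simp [coordFunctional_apply]
  have hnorm : ∀ x, ‖L x‖ = ‖x‖ := fun x => by
    refine le_antisymm 
      ((L x).opNorm_le_bound (norm_nonneg x) fun y => (w.summable_mul x y).2) ?_
    refine ENNReal.toReal_le_of_le_ofReal (norm_nonneg _) ?_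
    have h := w.eNorm_le_of_functional (L x)
    simp only [hLe] at h
    exact h
  have hsurj : Function.Surjective L := fun f => by
    have hf : (fun n => f (w.coordFunctional n)) ∈ w.lorentz.carrier :=
      (w.eNorm_le_of_functional f).trans_lt ENNReal.ofReal_lt_top
    refine ⟨.mk _ hf, ?_⟩
    ext y
    refine tendsto_nhds_unique (((L _).continuous.tendsto y).comp (w.tendsto_sum_coordFunctional y)) ?_
    refine ((f.continuous.tendsto y).comp (w.tendsto_sum_coordFunctional y)).congr fun N => ?_
    simp only [Function.comp_apply, map_sum, map_smul]
    exact Finset.sum_congr rfl fun n _ => by rw [hLe, SeqLattice.Elem.mk_coords]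
  let Φ : LorentzSpace w ≃ₗᵢ[ℝ] StrongDual ℝ (LorentzPredual w) :=
    LinearIsometryEquiv.ofSurjective { toLinearMap := L, norm_map' := hnorm } hsurj
  have hΦ : ∀ x, Φ x = L x := fun x => rfl
  refine ⟨Φ, fun x y => (w.summable_mul x y).1.hasSum, fun x => ⟨fun hx y hy => ?_, fun h n => ?_⟩⟩
  · rw [hΦ, hL]
    exact tsum_nonneg fun n => mul_nonneg (hx n) (hy n)
  · have := h (w.coordFunctional n) (SeqLattice.Elem.le_def.2 fun k => by
      rw [coordFunctional_apply]
      split_ifs <;> simp)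
    rw [hΦ, hLe] at this
    exact this

end LorentzWeight

/-! ### The weak Dunford–Pettis property -/

/-- A bounded operator is weakly compact if it maps the closed unit ball to a relatively weakly
compact set. -/
def IsWeaklyCompactOperator {E F : Type*} [NormedAddCommGroup E] [NormedSpace ℝ E]
    [NormedAddCommGroup F] [NormedSpace ℝ F] (T : E →L[ℝ] F) : Prop :=
  IsCompact (closure ((fun x => toWeakSpace ℝ F (T x)) '' Metric.closedBall (0 : E) 1))

/-- The weak Dunford–Pettis property of a Banach lattice `E`: every weakly compact operator from `E`
to a Banach space maps weakly null sequences of pairwise disjoint vectors to norm null sequences. -/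
def WeakDunfordPettis.{u} (E : Type u) [NormedAddCommGroup E] [NormedSpace ℝ E] [CompleteSpace E]
    [Lattice E] [IsOrderedAddMonoid E] [PosSMulMono ℝ E] [HasSolidNorm E] : Prop :=
  ∀ (F : Type u) [NormedAddCommGroup F] [NormedSpace ℝ F] [CompleteSpace F] (T : E →L[ℝ] F),
    IsWeaklyCompactOperator T →
    ∀ x : ℕ → E, (∀ i j, i ≠ j → |x i| ⊓ |x j| = 0) →
      (∀ φ : StrongDual ℝ E, Tendsto (fun n => φ (x n)) atTop (𝓝 0)) →
      Tendsto (fun n => ‖T (x n)‖) atTop (𝓝 0)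

/-! ### A criterion for the failure of the weak Dunford–Pettis property -/

/-! ### The space `c₀` and its dual `ℓ¹`. -/

namespace ZeroAtInftyContinuousMap

open scoped ZeroAtInfty

/-! One operator defeats the property in both spaces: the inclusion into `c₀`. The unit vectors are
pairwise disjoint and keep norm 1 in `c₀`, so it is enough that the inclusion is defined and weakly
compact and that the unit vectors are weakly null.

Weak compactness (`isWeaklyCompactOperator_toZeroAtInfty`): both norms are suprema of sums of
continuous functions of the coordinates, so the set of all sequences of norm at most 1 is compact
for coordinatewise convergence. It consists of null sequences, and on bounded subsets of `c₀`
coordinatewise convergence is weak convergence because the dual of `c₀` is `ℓ¹`.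

Put `W N = w 0 + ⋯ + w (N - 1)`. Everything else rests on two facts about `W`. Since `W` is
unbounded, a sequence of finite Lorentz norm is null (`tendsto_zero_of_eNorm_lt_top`). Since `W N /
N → 0`, a sequence whose absolute sums over `N` indices are `O(W N)` is null
(`tendsto_zero_of_sum_le`). The first gives the inclusion of `d(w;1)` and the weak nullity of the
unit vectors in `d_*(w;1)`, whose functionals are elements of `d(w;1)`; the second gives the other
two statements. -/

/-- A null sequence as a function vanishing at infinity on the discrete space `ℕ`. -/
def ofTendsto (x : ℕ → ℝ) (hx : Tendsto x atTop (𝓝 0)) : C₀(ℕ, ℝ) where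
  toFun := x
  continuous_toFun := continuous_of_discreteTopology
  zero_at_infty' := by rwa [cocompact_eq_atTop]

@[simp] theorem ofTendsto_apply (x : ℕ → ℝ) (hx : Tendsto x atTop (𝓝 0)) (n : ℕ) :
    ofTendsto x hx n = x n := rfl

theorem norm_le_iff {f : C₀(ℕ, ℝ)} {C : ℝ} (hC : 0 ≤ C) : ‖f‖ ≤ C ↔ ∀ n, |f n| ≤ C := by
  rw [← norm_toBCF_eq_norm, BoundedContinuousFunction.norm_le hC]
  rfl

theorem abs_apply_le_norm (f : C₀(ℕ, ℝ)) (n : ℕ) : |f n| ≤ ‖f‖ :=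
  (norm_le_iff (norm_nonneg f)).1 le_rfl n

theorem sum_coe_apply (s : Finset ℕ) (f : ℕ → C₀(ℕ, ℝ)) (n : ℕ) :
    (∑ i ∈ s, f i) n = ∑ i ∈ s, f i n := by
  induction s using Finset.induction_on with
  | empty => simp
  | insert a s ha ih => rw [Finset.sum_insert ha, Finset.sum_insert ha, add_apply, ih]

/-- The `n`-th unit vector of `c₀`. -/
noncomputable def unitVector (n : ℕ) : C₀(ℕ, ℝ) :=
  ofTendsto (Pi.single n 1) (tendsto_const_nhds.congr' ((eventually_gt_atTop n).mono fun k hk => by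
    rw [Pi.single_eq_of_ne hk.ne']))

theorem unitVector_apply (n k : ℕ) : unitVector n k = if k = n then 1 else 0 :=
  Pi.single_apply _ _ _

theorem tendsto_sum_unitVector (f : C₀(ℕ, ℝ)) :
    Tendsto (fun N => ∑ n ∈ Finset.range N, f n • unitVector n) atTop (𝓝 f) := by
  have hf : Tendsto f atTop (𝓝 0) := by
    simpa only [cocompact_eq_atTop] using ZeroAtInftyContinuousMapClass.zero_at_infty f
  rw [Metric.tendsto_atTop]
  intro ε hε
  obtain ⟨N, hN⟩ := Metric.tendsto_atTop.1 hf (ε / 2) (by positivity)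
  refine ⟨N, fun M hM => ?_⟩
  rw [dist_eq_norm]
  refine lt_of_le_of_lt ((norm_le_iff (by positivity)).2 fun k => ?_) (half_lt_self hε)
  simp only [sub_apply, sum_coe_apply, smul_apply, unitVector_apply, smul_eq_mul, mul_ite, mul_one,
    mul_zero, Finset.sum_ite_eq, Finset.mem_range]
  split_ifs with hk
  · simp only [sub_self, abs_zero]
    positivity
  · have := hN k (by omega)
    rw [Real.dist_0_eq_abs] at this
    simpa using this.le

/-- A finite sum of unit vectors with the signs of `φ (unitVector n)` has sup norm at most 1, so
`‖φ‖` bounds every partial sum. -/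
theorem summable_abs_unitVector (φ : StrongDual ℝ C₀(ℕ, ℝ)) :
    Summable fun n => |φ (unitVector n)| := by
  refine summable_of_sum_le (fun _ => abs_nonneg _) (c := ‖φ‖) fun s => ?_
  let y : C₀(ℕ, ℝ) := ∑ n ∈ s, (SignType.sign (φ (unitVector n)) : ℝ) • unitVector n
  have hy : ‖y‖ ≤ 1 := (norm_le_iff zero_le_one).2 fun k => by
    simp only [y, sum_coe_apply, smul_apply, unitVector_apply, smul_eq_mul, mul_ite, mul_one,
      mul_zero, Finset.sum_ite_eq]
    split_ifs
    · rcases lt_trichotomy (φ (unitVector k)) 0 with h | h | h <;> simp [h]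
    · simp
  calc ∑ n ∈ s, |φ (unitVector n)| = φ y := by
        simp only [y, map_sum, map_smul, smul_eq_mul, sign_mul_self]
    _ ≤ ‖φ‖ * ‖y‖ := (le_abs_self _).trans (φ.le_opNorm y)
    _ ≤ ‖φ‖ := mul_le_of_le_one_right (norm_nonneg φ) hy

theorem hasSum_unitVector (φ : StrongDual ℝ C₀(ℕ, ℝ)) (f : C₀(ℕ, ℝ)) :
    HasSum (fun n => f n * φ (unitVector n)) (φ f) := by
  have hs : Summable fun n => f n * φ (unitVector n) := by
    refine Summable.of_norm_bounded ((summable_abs_unitVector φ).mul_left ‖f‖) fun n => ?_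
    rw [norm_mul]
    exact mul_le_mul_of_nonneg_right (abs_apply_le_norm f n) (norm_nonneg _)
  refine (hs.hasSum_iff_tendsto_nat).2 ?_
  refine ((φ.continuous.tendsto f).comp (tendsto_sum_unitVector f)).congr fun N => ?_
  simp [map_sum]

end ZeroAtInftyContinuousMap

/-! ### Weak compactness of the inclusion into `c₀`. -/

namespace SeqLattice

open scoped ZeroAtInfty
open ZeroAtInftyContinuousMap

variable {S : SeqLattice}

/-- The inclusion into `c₀` of a sequence lattice consisting of null sequences. -/
noncomputable def toZeroAtInfty {C : ℝ≥0} (hC : ∀ x n, ‖x n‖ₑ ≤ C * S.eNorm x)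
    (h0 : ∀ x, S.eNorm x < ∞ → Tendsto x atTop (𝓝 0)) : S.Elem →L[ℝ] C₀(ℕ, ℝ) :=
  LinearMap.mkContinuous
    { toFun := fun x => ofTendsto x (h0 x (S.lt_top _ x.mem))
      map_add' := fun _ _ => rfl
      map_smul' := fun _ _ => rfl } C fun x => by
    refine (norm_le_iff (by positivity)).2 fun n => ?_
    have := ENNReal.toReal_mono (ENNReal.mul_ne_top (by simp) x.ne_top) (hC x n)
    rw [ENNReal.toReal_mul, toReal_enorm] at this
    exact this

/-- On a bounded set of null sequences, coordinatewise convergence is weak convergence in `c₀`. So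
the inclusion into `c₀` is weakly compact if the unit ball of the lattice norm is closed under
coordinatewise convergence. -/
theorem isWeaklyCompactOperator_toZeroAtInfty {C : ℝ≥0} (hC : ∀ x n, ‖x n‖ₑ ≤ C * S.eNorm x)
    (h0 : ∀ x, S.eNorm x < ∞ → Tendsto x atTop (𝓝 0)) (hS : LowerSemicontinuous S.eNorm) :
    IsWeaklyCompactOperator (toZeroAtInfty hC h0) := by
  -- `K` is not restricted to `carrier`: the unit ball of `d_*(w;1)` is not closed under
  -- coordinatewise limits. For instance, `w` is the limit of its truncations, but its tails keep
  -- dual norm 1.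
  let K : Set (ℕ → ℝ) := {x | S.eNorm x ≤ 1}
  have hbound : ∀ x ∈ K, ∀ n, |x n| ≤ C := fun x hx n => by
    have h : ‖x n‖ₑ ≤ C := (hC x n).trans (mul_le_of_le_one_right' hx)
    simpa using ENNReal.toReal_mono (by simp) h
  have hK : IsCompact K := by
    refine (isCompact_univ_pi (s := fun _ : ℕ => Set.Icc (-(C : ℝ)) C)
      fun _ => isCompact_Icc).of_isClosed_subset (hS.isClosed_preimage 1) fun x hx n _ => ?_
    exact abs_le.1 (hbound x hx n)
  have := isCompact_iff_compactSpace.1 hK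
  let g : K → WeakSpace ℝ C₀(ℕ, ℝ) := fun x =>
    toWeakSpace ℝ _ (ofTendsto x (h0 x (lt_of_le_of_lt x.2 ENNReal.one_lt_top)))
  have hg : Continuous g := by
    refine WeakBilin.continuous_of_continuous_eval _ fun φ => ?_
    have h : ∀ x : K, topDualPairing ℝ C₀(ℕ, ℝ) φ (g x)
        = ∑' n, (x : ℕ → ℝ) n * φ (unitVector n) := fun x => (hasSum_unitVector φ _).tsum_eq.symm
    refine Continuous.congr ?_ fun x => (h x).symm
    -- Weierstrass test: the coordinates are bounded by `C` on `K` and `φ` is in `ℓ¹`, so the series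
    -- converges uniformly on `K`.
    refine continuous_tsum (u := fun n => C * |φ (unitVector n)|) (fun n => ?_)
      ((summable_abs_unitVector φ).mul_left _) fun n x => ?_
    · exact ((continuous_apply n).comp continuous_subtype_val).mul continuous_const
    · rw [norm_mul]
      exact mul_le_mul_of_nonneg_right (hbound x x.2 n) (abs_nonneg _)
  -- The image of the ball need not be closed; it only has to lie in the weakly compact range of
  -- `g`.
  refine (isCompact_range hg).closure_of_subset ?_
  rintro _ ⟨x, hx, rfl⟩
  refine ⟨⟨x, ?_⟩, rfl⟩
  rw [mem_closedBall_zero_iff] at hx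
  show S.eNorm x ≤ 1
  rw [← Elem.ofReal_norm_eq]
  exact ENNReal.ofReal_le_one.2 hx

theorem not_weakDunfordPettis {C : ℝ≥0} (hC : ∀ x n, ‖x n‖ₑ ≤ C * S.eNorm x)
    (h0 : ∀ x, S.eNorm x < ∞ → Tendsto x atTop (𝓝 0)) (hS : LowerSemicontinuous S.eNorm)
    (he : ∀ n, Pi.single n 1 ∈ S.carrier)
    (hweak : ∀ φ : StrongDual ℝ S.Elem, Tendsto (fun n => φ (.mk _ (he n))) atTop (𝓝 0)) :
    ¬ WeakDunfordPettis S.Elem := by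
  intro h
  have hlim := h _ _ (isWeaklyCompactOperator_toZeroAtInfty hC h0 hS) (fun n => .mk _ (he n))
    (fun i j hij => by
      ext k
      simp only [Elem.inf_apply, Elem.abs_apply, Elem.mk_coords, Elem.zero_apply, Pi.single_apply]
      split_ifs with h1 h2
      · exact absurd (h1.symm.trans h2) hij
      all_goals simp) hweak
  -- The images have norm at least 1, read off at the `n`-th coordinate, so their norms cannot tend
  -- to 0.
  refine absurd (ge_of_tendsto' hlim fun n => ?_) (not_le.2 one_pos)
  refine le_trans ?_ (abs_apply_le_norm _ n)
  show 1 ≤ |(Pi.single n 1 : ℕ → ℝ) n|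
  simp

end SeqLattice

/-! ### Null sequences in Lorentz spaces and their preduals -/

namespace LorentzWeight

variable (w : LorentzWeight)

/-! ### Decay of sequences of finite norm. -/

/-- Adding elements in increasing order, each new element is at least the number of those already
present, and `w` is nonincreasing. -/
theorem sum_le_sum_range_card (s : Finset ℕ) : ∑ n ∈ s, w n ≤ ∑ n ∈ Finset.range s.card, w n := by
  induction s using Finset.induction_on_max with
  | empty => simp
  | insert a s ha ih =>
    have has : a ∉ s := fun h => (ha a h).false
    have hcard : s.card ≤ a := by
      simpa using Finset.card_le_card (fun n hn => Finset.mem_range.2 (ha n hn) : s ⊆ Finset.range a)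
    rw [Finset.sum_insert has, Finset.card_insert_of_notMem has, Finset.sum_range_succ, add_comm]
    exact add_le_add ih (w.antitone hcard)

/-- Under a permutation `σ` only the weights at indices in `σ⁻¹(s)` count, and their sum is largest
for the first `s.card` weights. -/
theorem eNorm_indicator_le (x : ℕ → ℝ) (s : Finset ℕ) (h1 : ∀ n, |x n| ≤ 1)
    (h2 : ∀ n ∉ s, x n = 0) :
    w.eNorm x ≤ ENNReal.ofReal (∑ n ∈ Finset.range s.card, w n) := by
  refine iSup_le fun σ => ?_
  rw [tsum_eq_sum (s := s.map σ.symm.toEmbedding) fun n hn => by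
    rw [h2 (σ n) fun h => hn (Finset.mem_map.2 ⟨σ n, h, by simp⟩)]
    simp]
  calc ∑ n ∈ s.map σ.symm.toEmbedding, ‖w n‖ₑ * ‖x (σ n)‖ₑ
      ≤ ∑ n ∈ s.map σ.symm.toEmbedding, ENNReal.ofReal (w n) :=
        Finset.sum_le_sum fun n _ => by
          rw [Real.enorm_of_nonneg (w.pos n).le, Real.enorm_eq_ofReal_abs]
          exact mul_le_of_le_one_right' (ENNReal.ofReal_le_one.2 (h1 _))
    _ = ENNReal.ofReal (∑ n ∈ s.map σ.symm.toEmbedding, w n) :=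
        (ENNReal.ofReal_sum_of_nonneg fun n _ => (w.pos n).le).symm
    _ ≤ _ := by
        refine ENNReal.ofReal_le_ofReal ((w.sum_le_sum_range_card _).trans_eq ?_)
        rw [Finset.card_map]

/-- A sequence is null if its sums over sets of `N` indices are `O(w 0 + ⋯ + w (N - 1))`. -/
theorem tendsto_zero_of_sum_le {a : ℕ → ℝ} {C : ℝ}
    (h : ∀ s : Finset ℕ, ∑ n ∈ s, |a n| ≤ C * ∑ n ∈ Finset.range s.card, w n) :
    Tendsto a atTop (𝓝 0) := by
  by_contra hcon
  rw [Metric.tendsto_nhds] at hcon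
  push Not at hcon
  obtain ⟨ε, hε, hfreq⟩ := hcon
  have hinf := Nat.frequently_atTop_iff_infinite.1 hfreq
  -- The Cesàro means of `w` tend to 0, so for some `N > 0` the bound falls below `N * ε`, while `N`
  -- indices with `|a n| ≥ ε` have absolute sum at least `N * ε`.
  have hlim := (w.tendsto_zero.cesaro).const_mul C
  rw [mul_zero] at hlim
  obtain ⟨N, hN, hN0⟩ := ((hlim.eventually_lt_const hε).and (eventually_gt_atTop 0)).exists
  obtain ⟨s, hs, rfl⟩ := hinf.exists_subset_card_eq N
  have hpos : (0 : ℝ) < s.card := by exact_mod_cast hN0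
  have h1 : s.card • ε ≤ ∑ n ∈ s, |a n| := Finset.card_nsmul_le_sum _ _ _ fun n hn => by
    simpa [Real.dist_0_eq_abs] using hs hn
  rw [nsmul_eq_mul] at h1
  have h2 : C * ((s.card : ℝ)⁻¹ * ∑ n ∈ Finset.range s.card, w n) * s.card
      = C * ∑ n ∈ Finset.range s.card, w n := by
    field_simp
  have h3 := mul_lt_mul_of_pos_right hN hpos
  rw [h2] at h3
  linarith [h s]

/-- The Lorentz norm allows only permutations; this lets an injective enumeration of a subset serve
on any initial segment. Swapping `σ N` with `f N` corrects the value at `N` and, by injectivity of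
`σ` and `f`, leaves the earlier ones alone. -/
theorem exists_perm_eq_of_lt {f : ℕ → ℕ} (hf : Function.Injective f) (N : ℕ) :
    ∃ σ : Equiv.Perm ℕ, ∀ n < N, σ n = f n := by
  induction N with
  | zero => exact ⟨1, by simp⟩
  | succ N ih =>
    obtain ⟨σ, hσ⟩ := ih
    refine ⟨Equiv.swap (σ N) (f N) * σ, fun n hn => ?_⟩
    rw [Equiv.Perm.mul_apply]
    rcases Nat.lt_succ_iff_lt_or_eq.1 hn with h | rfl
    · rw [Equiv.swap_apply_of_ne_of_ne (fun e => h.ne (σ.injective e)), hσ n h]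
      rw [hσ n h]
      exact fun e => h.ne (hf e)
    · exact Equiv.swap_apply_left _ _

/-- If `|x n| ≥ ε` infinitely often, a permutation can place `N` such entries against the first `N`
weights. Then `ε * (w 0 + ⋯ + w (N - 1))` is at most the norm for every `N`, against the divergence
of `∑ w n`. -/
theorem tendsto_zero_of_eNorm_lt_top {x : ℕ → ℝ} (hx : w.eNorm x < ∞) :
    Tendsto x atTop (𝓝 0) := by
  by_contra hcon
  rw [Metric.tendsto_nhds] at hcon
  push Not at hcon
  obtain ⟨ε, hε, hfreq⟩ := hcon
  have hinf := Nat.frequently_atTop_iff_infinite.1 hfreq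
  refine w.not_summable (summable_of_sum_range_le (c := (w.eNorm x).toReal / ε)
    (fun n => (w.pos n).le) fun N => ?_)
  obtain ⟨σ, hσ⟩ := exists_perm_eq_of_lt (Nat.nth_injective hinf) N
  rw [le_div_iff₀ hε, Finset.sum_mul]
  refine (ENNReal.ofReal_le_iff_le_toReal hx.ne).1 ?_
  rw [ENNReal.ofReal_sum_of_nonneg fun n _ => mul_nonneg (w.pos n).le hε.le]
  refine le_trans (Finset.sum_le_sum fun n hn => ?_) ((ENNReal.sum_le_tsum (Finset.range N)).trans
    (le_iSup (fun σ : Equiv.Perm ℕ => ∑' n, ‖w n‖ₑ * ‖x (σ n)‖ₑ) σ))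
  rw [ENNReal.ofReal_mul (w.pos n).le, Real.enorm_of_nonneg (w.pos n).le, Real.enorm_eq_ofReal_abs,
    hσ n (Finset.mem_range.1 hn)]
  gcongr
  simpa [Real.dist_0_eq_abs] using Nat.nth_mem_of_infinite hinf n

theorem sum_range_pos {N : ℕ} (hN : 0 < N) : 0 < ∑ n ∈ Finset.range N, w n :=
  Finset.sum_pos (fun n _ => w.pos n) (Finset.nonempty_range_iff.2 hN.ne')

/-- Test `y` against the indicator of `s` divided by `w 0 + ⋯ + w (s.card - 1)`, which lies in the
Lorentz unit ball. -/
theorem sum_abs_le_dualENorm {y : ℕ → ℝ} (hy : w.dualENorm y < ∞) (s : Finset ℕ) :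
    ∑ n ∈ s, |y n| ≤ (w.dualENorm y).toReal * ∑ n ∈ Finset.range s.card, w n := by
  rcases s.eq_empty_or_nonempty with rfl | hs
  · simp
  have hW := w.sum_range_pos hs.card_pos
  set W := ∑ n ∈ Finset.range s.card, w n
  let x : ℕ → ℝ := fun n => if n ∈ s then 1 else 0
  have hx : w.eNorm (W⁻¹ • x) ≤ 1 := by
    refine (w.eNorm_smul_le _ _).trans ?_
    have h := w.eNorm_indicator_le x s (fun n => by simp only [x]; split_ifs <;> simp)
      (fun n hn => by simp [x, hn])
    refine (mul_le_mul_right h _).trans_eq ?_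
    rw [Real.enorm_of_nonneg (inv_pos.2 hW).le, ← ENNReal.ofReal_mul (inv_pos.2 hW).le,
      inv_mul_cancel₀ hW.ne', ENNReal.ofReal_one]
  rw [← div_le_iff₀ hW]
  refine (ENNReal.ofReal_le_iff_le_toReal hy.ne).1 ?_
  rw [Finset.sum_div, ENNReal.ofReal_sum_of_nonneg fun n _ => div_nonneg (abs_nonneg _) hW.le]
  refine le_trans (Finset.sum_le_sum fun n hn => le_of_eq ?_) ((ENNReal.sum_le_tsum s).trans
    (le_iSup₂ (f := fun (z : ℕ → ℝ) (_ : w.eNorm z ≤ 1) => ∑' n, ‖z n‖ₑ * ‖y n‖ₑ) _ hx))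
  simp only [x, Pi.smul_apply, hn, if_true, smul_eq_mul, mul_one]
  rw [← enorm_mul, Real.enorm_eq_ofReal_abs, abs_mul, abs_of_pos (inv_pos.2 hW), div_eq_inv_mul]

theorem tendsto_zero_of_dualENorm_lt_top {y : ℕ → ℝ} (hy : w.dualENorm y < ∞) :
    Tendsto y atTop (𝓝 0) :=
  w.tendsto_zero_of_sum_le (w.sum_abs_le_dualENorm hy)

/-! ### Semicontinuity of the norms and weak nullity of the unit vectors. -/

theorem lowerSemicontinuous_eNorm : LowerSemicontinuous w.eNorm :=
  lowerSemicontinuous_iSup fun σ => lowerSemicontinuous_tsum fun n =>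
    ((ENNReal.continuous_const_mul enorm_ne_top).comp (continuous_apply (σ n)).enorm).lowerSemicontinuous

theorem lowerSemicontinuous_dualENorm : LowerSemicontinuous w.dualENorm :=
  lowerSemicontinuous_iSup fun _ => lowerSemicontinuous_iSup fun _ =>
    lowerSemicontinuous_tsum fun n => ((ENNReal.continuous_const_mul enorm_ne_top).comp
      (continuous_apply n).enorm).lowerSemicontinuous

theorem single_mem_lorentz (n : ℕ) : Pi.single n 1 ∈ w.lorentz.carrier :=
  (w.eNorm_single_le n 1).trans_lt (ENNReal.mul_lt_top (by simp) (by simp))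

/-- Evaluating `φ` at a sum of unit vectors over `s` with matching signs, of norm at most `w 0 + ⋯ +
w (s.card - 1)`, gives the growth bound that `tendsto_zero_of_sum_le` needs. -/
theorem tendsto_functional_single (φ : StrongDual ℝ (LorentzSpace w)) :
    Tendsto (fun n => φ (.mk _ (w.single_mem_lorentz n))) atTop (𝓝 0) := by
  refine w.tendsto_zero_of_sum_le (C := ‖φ‖) fun s => ?_
  let e : ℕ → LorentzSpace w := fun n => .mk _ (w.single_mem_lorentz n)
  let x : LorentzSpace w := ∑ n ∈ s, (SignType.sign (φ (e n)) : ℝ) • e n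
  have hxk : ∀ k, x k = if k ∈ s then (SignType.sign (φ (e k)) : ℝ) else 0 := fun k => by
    simp [x, e, SeqLattice.Elem.sum_apply, Pi.single_apply]
  have hx : ‖x‖ ≤ ∑ n ∈ Finset.range s.card, w n := by
    refine ENNReal.toReal_le_of_le_ofReal (Finset.sum_nonneg fun n _ => (w.pos n).le)
      (w.eNorm_indicator_le x s (fun k => ?_) fun k hk => by simp [hxk, hk])
    rw [hxk]
    split_ifs
    · rcases lt_trichotomy (φ (e k)) 0 with h | h | h <;> simp [h]
    · simp
  calc ∑ n ∈ s, |φ (e n)| = φ x := by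
        simp only [x, map_sum, map_smul, smul_eq_mul, sign_mul_self]
    _ ≤ ‖φ‖ * ‖x‖ := (le_abs_self _).trans (φ.le_opNorm x)
    _ ≤ _ := mul_le_mul_of_nonneg_left hx (norm_nonneg _)

theorem enorm_apply_le_eNorm (x : ℕ → ℝ) (n : ℕ) : ‖x n‖ₑ ≤ ((‖w 0‖₊)⁻¹ : ℝ≥0) * w.eNorm x := by
  rw [ENNReal.coe_inv (by simpa using (w.pos 0).ne'), mul_comm, ← div_eq_mul_inv]
  refine (ENNReal.le_div_iff_mul_le (Or.inl (w.enorm_ne_zero' 0)) (Or.inl enorm_ne_top)).2 ?_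
  rw [mul_comm]
  exact w.coord_le_eNorm x n

theorem not_weakDunfordPettis_lorentzSpace : ¬ WeakDunfordPettis (LorentzSpace w) :=
  SeqLattice.not_weakDunfordPettis (S := w.lorentz) w.enorm_apply_le_eNorm
    (fun _ => w.tendsto_zero_of_eNorm_lt_top) w.lowerSemicontinuous_eNorm w.single_mem_lorentz
    w.tendsto_functional_single

/-- Here weak nullity comes from duality: the values of a functional at the unit vectors form a
sequence of finite Lorentz norm, hence a null sequence. -/
theorem not_weakDunfordPettis_lorentzPredual : ¬ WeakDunfordPettis (LorentzPredual w) :=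
  SeqLattice.not_weakDunfordPettis (S := w.lorentzPredual) (C := ‖w 0‖₊) w.coord_le_dualENorm
    (fun _ => w.tendsto_zero_of_dualENorm_lt_top) w.lowerSemicontinuous_dualENorm
    (fun n => (w.coordFunctional n).mem) fun φ =>
      w.tendsto_zero_of_eNorm_lt_top ((w.eNorm_le_of_functional φ).trans_lt ENNReal.ofReal_lt_top)

end LorentzWeight

theorem mainTheorem12 (w : LorentzWeight) :
    ¬ WeakDunfordPettis (LorentzSpace w) ∧ ¬ WeakDunfordPettis (LorentzPredual w) :=
  ⟨w.not_weakDunfordPettis_lorentzSpace, w.not_weakDunfordPettis_lorentzPredual⟩
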